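/- **2-SCSS-$(k_1,k_2)$.** Given a digraph $G=(V,E)$ with weights $\omega:E\to\mathbb R_{\ge 0}$ and $s,t\in V$, choose directed (simple) paths $F_1,\dots,F_{k_1}$ from $s$ to $t$ and $B_1,\dots,B_{k_2}$ from $t$ to $s$, repetitions allowed, so as to minimize $\sum_{e\in E}\omega(e)\,\varphi(e)$, where $\varphi(e)=\max\{|\{i: e\in F_i\}|,\ |\{j: e\in B_j\}|\}$. The minimum is denoted OPT. **Grid Tiling\*.** An instance consists of integers $k\ge 1$, $m$ and non-empty sets $S_{i,j}\subseteq[m]\times[m]$ ($1\le i,j\le k$) such that $(x,y)\in S_{i,i}$ if and only if $x=y$. A solution is a choice of $\gamma_{i,j}\in S_{i,j}$ for all $i,j\in[k]$ such that $\gamma_{i,j}$ and $\gamma_{i,j+1}$ have the same first coordinate and $\gamma_{i,j}$ and $\gamma_{i+1,j}$ have the same second coordinate, whenever these are defined. **Construction.** Put $n=m+1$ and add a dummy first row and column: let $S'_{i,j}=\{(x+1,y+1):(x,y)\in S_{i,j}\}\subseteq[n]\times[n]$. Assume $k\le n$. Let $\Delta=7n^6$ and $W=53n^9$. Build the following weighted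 digraph. * For $i,j\in[k]$ the gadget $G_{i,j}$ is an $n\times n$ grid with vertices $g_{i,j}(x,y)$, $x$ being the row (numbered downwards) and $y$ the column (numbered rightwards). Black edges have weight $4$ and are directed to the right and downwards. * For $i\in[k]$ and $x\in[n]$, the horizontal canonical path $P_i^x$ starts at $a_i$, takes a blue edge to an extra vertex, then follows black edges through row $x$ of $G_{i,1},G_{i,2},\dots,G_{i,k}$ in this order to another extra vertex, and takes a blue edge to $b_i$. For $j\in[k]$ and $y\in[n]$, the vertical canonical path $Q_j^y$ goes in the same way from $c_j$, through column $y$ of $G_{1,j},G_{2,j},\dots,G_{k,j}$, to $d_j$. Thus each canonical path has $2$ blue edges, $k+1$ black edges outside the gadgets, and $n-1$ black edges inside each of the $k$ gadgets it visits. The extra vertices belong to one canonical path each. The first blue edge of $P_i^\ell$ and the first blue edge of $Q_i^\ell$ have weight $\Delta(nk-ni+n+1-\ell)$, and the last blue edge of each has weight $\Delta(ni-n+\ell)$. * For each $(x,y)\in S'_{i,j}$, let $r=g_{i,j}(x,y)$, $p=g_{i,j}(x-1,y)$ and $u=g_{i,j}(x,y-1)$. The edge $(p,r)$ is subdivided by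 a new vertex $q$, where $(p,q)$ and $(q,r)$ have weight $2$, and a shortcut edge $(u,q)$ is added, of weight $2$ if $i=j$ (green) and of weight $3$ if $i\ne j$ (orange). * There are further vertices $s,t$, and $e_i,f_i$ for $2\le i\le k$. There are weight-$0$ edges $(s,c_i)$ and $(d_i,t)$ for $i\in[k]$; $(t,a_k)$; $(b_1,s)$; and $(s,e_i)$, $(f_i,t)$, $(b_i,e_i)$, $(f_i,a_{i-1})$ for $2\le i\le k$. There are connector edges $(e_i,f_i)$ of weight $W$ for $2\le i\le k$. Let $\alpha=\Delta(nk+1)+4(k+1)+4k(n-1)$ and $\beta=2k\alpha+W(k-1)-(k^2+k)$. **Theorem.** If the optimum OPT of 2-SCSS-$(2k-1,1)$ on this instance is at most $\beta$, then the Grid Tiling\* instance has a solution. -/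

import Mathlib

/-! ### The 2-SCSS-(k₁, k₂) problem -/

/-- A digraph with vertex set `V`, edge set `E` (each edge is determined by its tail and head)
and nonnegative real edge weights. -/
structure WeightedDigraph (V E : Type*) where
  /-- tail of an edge -/
  src : E → V
  /-- head of an edge -/
  tgt : E → V
  simple : Function.Injective fun e => (src e, tgt e)
  weight : E → ℝ
  weight_nonneg : ∀ e, 0 ≤ weight e

namespace WeightedDigraph

variable {V E : Type*}

/-- The list of edges `p` is a directed walk from `u` to `v`. -/
def IsWalk (G : WeightedDigraph V E) : V → List E → V → Prop
  | u, [], v => u = v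
  | u, e :: p, v => G.src e = u ∧ IsWalk G (G.tgt e) p v

/-- A directed path from `u` to `v`: a directed walk that repeats no vertex. -/
structure DiPath (G : WeightedDigraph V E) (u v : V) where
  edges : List E
  isWalk : G.IsWalk u edges v
  nodup : (u :: edges.map G.tgt).Nodup

/-- A feasible solution of 2-SCSS-(k₁, k₂): paths `F₁, …, F_{k₁}` from `s` to `t` and paths
`B₁, …, B_{k₂}` from `t` to `s` (repetitions allowed). -/
structure Solution (G : WeightedDigraph V E) (s t : V) (k₁ k₂ : ℕ) where
  F : Fin k₁ → G.DiPath s t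
  B : Fin k₂ → G.DiPath t s

open Classical in
/-- `φ(e) = max (#{i : e ∈ F_i}) (#{j : e ∈ B_j})`. -/
noncomputable def Solution.mult {G : WeightedDigraph V E} {s t : V} {k₁ k₂ : ℕ}
    (X : G.Solution s t k₁ k₂) (e : E) : ℕ :=
  max (Finset.univ.filter fun i => e ∈ (X.F i).edges).card
    (Finset.univ.filter fun j => e ∈ (X.B j).edges).card

/-- The cost `∑ e, ω(e) φ(e)`. -/
noncomputable def Solution.cost [Fintype E] {G : WeightedDigraph V E} {s t : V} {k₁ k₂ : ℕ}
    (X : G.Solution s t k₁ k₂) : ℝ :=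
  ∑ e, G.weight e * (X.mult e : ℝ)

/-- The optimum of 2-SCSS-(k₁, k₂) on `(G, s, t)` (it is `⊤` if there is no solution). -/
noncomputable def opt [Fintype E] (G : WeightedDigraph V E) (s t : V) (k₁ k₂ : ℕ) : EReal :=
  ⨅ X : G.Solution s t k₁ k₂, ((X.cost : ℝ) : EReal)

end WeightedDigraph

/-! ### Grid Tiling* -/

/-- An instance of `k × k` Grid Tiling* over `[m] × [m]`. -/
structure GridTilingStar (k m : ℕ) where
  S : Fin k → Fin k → Finset (Fin m × Fin m)
  nonempty : ∀ i j, (S i j).Nonempty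
  diag : ∀ i x y, (x, y) ∈ S i i ↔ x = y

namespace GridTilingStar

variable {k m : ℕ}

def HasSolution (I : GridTilingStar k m) : Prop :=
  ∃ γ : Fin k → Fin k → Fin m × Fin m,
    (∀ i j, γ i j ∈ I.S i j) ∧
    (∀ (i j : Fin k) (h : j.val + 1 < k), (γ i j).1 = (γ i ⟨j.val + 1, h⟩).1) ∧
    (∀ (i j : Fin k) (h : i.val + 1 < k), (γ i j).2 = (γ ⟨i.val + 1, h⟩ j).2)

/-- The sets after adding a dummy first row and a dummy first column: the old index `x` becomes
`x.succ`, and no element has the index `0` in either coordinate. The gadgets are built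
from these sets, so they are grids of side `n = m + 1`. -/
def dummy (I : GridTilingStar k m) (i j : Fin k) : Finset (Fin (m + 1) × Fin (m + 1)) :=
  (I.S i j).image fun p => (p.1.succ, p.2.succ)

/-! ### The constructed graph

All indices are counted from `0`, so `i : Fin k` is the paper-style index `i + 1 ∈ [k]`, and
`x : Fin (m + 1)` is `x + 1 ∈ [n]` with `n = m + 1`. -/

/-- Vertices. `grid i j x y` is the vertex of gadget `G_{i,j}` at which the horizontal canonical
path `P_i^x` and the vertical canonical path `Q_j^y` cross. The paths `P_i^x` and `Q_j^y` have one
further vertex before the first gadget (`left`, `top`) and one after the last gadget (`right`,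
`bottom`). `sub i j x y` subdivides the vertical edge into the coloured vertex
`grid i j x.succ y.succ`. `e i` and `f i` lie between `b_{i+1}` and `a_i`. -/
inductive Vertex (I : GridTilingStar k m) : Type
  | s
  | t
  | a (i : Fin k)
  | b (i : Fin k)
  | c (j : Fin k)
  | d (j : Fin k)
  | e (i : Fin k) (h : i.val + 1 < k)
  | f (i : Fin k) (h : i.val + 1 < k)
  | left (i : Fin k) (x : Fin (m + 1))
  | right (i : Fin k) (x : Fin (m + 1))
  | top (j : Fin k) (y : Fin (m + 1))
  | bottom (j : Fin k) (y : Fin (m + 1))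
  | grid (i j : Fin k) (x y : Fin (m + 1))
  | sub (i j : Fin k) (x y : Fin m) (h : (x, y) ∈ I.S i j)
  deriving DecidableEq, Fintype

/-- Edges; endpoints and weights are given by `Edge.src`, `Edge.tgt` and `Edge.weight`. -/
inductive Edge (I : GridTilingStar k m) : Type
  -- blue edges
  | blueA (i : Fin k) (x : Fin (m + 1))
  | blueB (i : Fin k) (x : Fin (m + 1))
  | blueC (j : Fin k) (y : Fin (m + 1))
  | blueD (j : Fin k) (y : Fin (m + 1))
  -- horizontal black edges: before the first gadget, inside a gadget, between consecutive
  -- gadgets, after the last gadget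
  | hFirst (i j : Fin k) (h : j.val = 0) (x : Fin (m + 1))
  | hIn (i j : Fin k) (x : Fin (m + 1)) (y : Fin m)
  | hNext (i j : Fin k) (h : j.val + 1 < k) (x : Fin (m + 1))
  | hLast (i j : Fin k) (h : j.val + 1 = k) (x : Fin (m + 1))
  -- vertical black edges; inside a gadget only those that are not subdivided
  | vFirst (i j : Fin k) (h : i.val = 0) (y : Fin (m + 1))
  | vIn (i j : Fin k) (x : Fin m) (y : Fin (m + 1)) (h : (x.succ, y) ∉ I.dummy i j)
  | vNext (i j : Fin k) (h : i.val + 1 < k) (y : Fin (m + 1))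
  | vLast (i j : Fin k) (h : i.val + 1 = k) (y : Fin (m + 1))
  -- at each coloured vertex: the two halves of the subdivided vertical edge, and the shortcut
  -- (green if `i = j`, orange otherwise) from the horizontal predecessor
  | subIn (i j : Fin k) (x y : Fin m) (h : (x, y) ∈ I.S i j)
  | subOut (i j : Fin k) (x y : Fin m) (h : (x, y) ∈ I.S i j)
  | shortcut (i j : Fin k) (x y : Fin m) (h : (x, y) ∈ I.S i j)
  -- terminals and connectors
  | sC (j : Fin k)
  | dT (j : Fin k)
  | tA (i : Fin k) (h : i.val + 1 = k)
  | bS (i : Fin k) (h : i.val = 0)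
  | sE (i : Fin k) (h : i.val + 1 < k)
  | fT (i : Fin k) (h : i.val + 1 < k)
  | bE (i : Fin k) (h : i.val + 1 < k)
  | connector (i : Fin k) (h : i.val + 1 < k)
  | fA (i : Fin k) (h : i.val + 1 < k)

variable {I : GridTilingStar k m}

def Edge.src : I.Edge → I.Vertex
  | .blueA i _ => .a i
  | .blueB i x => .right i x
  | .blueC j _ => .c j
  | .blueD j y => .bottom j y
  | .hFirst i _ _ x => .left i x
  | .hIn i j x y => .grid i j x y.castSucc
  | .hNext i j _ x => .grid i j x (Fin.last m)
  | .hLast i j _ x => .grid i j x (Fin.last m)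
  | .vFirst _ j _ y => .top j y
  | .vIn i j x y _ => .grid i j x.castSucc y
  | .vNext i j _ y => .grid i j (Fin.last m) y
  | .vLast i j _ y => .grid i j (Fin.last m) y
  | .subIn i j x y _ => .grid i j x.castSucc y.succ
  | .subOut i j x y h => .sub i j x y h
  | .shortcut i j x y _ => .grid i j x.succ y.castSucc
  | .sC _ => .s
  | .dT j => .d j
  | .tA _ _ => .t
  | .bS i _ => .b i
  | .sE _ _ => .s
  | .fT i h => .f i h
  | .bE i h => .b ⟨i.val + 1, h⟩
  | .connector i h => .e i h
  | .fA i h => .f i h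

def Edge.tgt : I.Edge → I.Vertex
  | .blueA i x => .left i x
  | .blueB i _ => .b i
  | .blueC j y => .top j y
  | .blueD j _ => .d j
  | .hFirst i j _ x => .grid i j x 0
  | .hIn i j x y => .grid i j x y.succ
  | .hNext i j h x => .grid i ⟨j.val + 1, h⟩ x 0
  | .hLast i _ _ x => .right i x
  | .vFirst i j _ y => .grid i j 0 y
  | .vIn i j x y _ => .grid i j x.succ y
  | .vNext i j h y => .grid ⟨i.val + 1, h⟩ j 0 y
  | .vLast _ j _ y => .bottom j y
  | .subIn i j x y h => .sub i j x y h
  | .subOut i j x y _ => .grid i j x.succ y.succ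
  | .shortcut i j x y h => .sub i j x y h
  | .sC j => .c j
  | .dT _ => .t
  | .tA i _ => .a i
  | .bS _ _ => .s
  | .sE i h => .e i h
  | .fT _ _ => .t
  | .bE i h => .e i h
  | .connector i h => .f i h
  | .fA i _ => .a i

/-- `Δ = 7 n ^ 6` with `n = m + 1`. -/
def Δ (m : ℕ) : ℝ := 7 * ((m + 1 : ℕ) : ℝ) ^ 6

/-- `W = 53 n ^ 9` with `n = m + 1`. -/
def W (m : ℕ) : ℝ := 53 * ((m + 1 : ℕ) : ℝ) ^ 9

/-- Weight `Δ (n k - n i + n + 1 - ℓ)` of the first blue edge of `P_i^ℓ` and of `Q_i^ℓ`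
(1-based `i`, `ℓ`). -/
def firstBlue (k m i ℓ : ℕ) : ℝ :=
  Δ m * (((m + 1 : ℕ) : ℝ) * k - ((m + 1 : ℕ) : ℝ) * i + ((m + 1 : ℕ) : ℝ) + 1 - ℓ)

/-- Weight `Δ (n i - n + ℓ)` of the last blue edge of `P_i^ℓ` and of `Q_i^ℓ`
(1-based `i`, `ℓ`). -/
def lastBlue (m i ℓ : ℕ) : ℝ :=
  Δ m * (((m + 1 : ℕ) : ℝ) * i - ((m + 1 : ℕ) : ℝ) + ℓ)

def Edge.weight : I.Edge → ℝ
  | .blueA i x => firstBlue k m (i.val + 1) (x.val + 1)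
  | .blueB i x => lastBlue m (i.val + 1) (x.val + 1)
  | .blueC j y => firstBlue k m (j.val + 1) (y.val + 1)
  | .blueD j y => lastBlue m (j.val + 1) (y.val + 1)
  | .hFirst _ _ _ _ => 4
  | .hIn _ _ _ _ => 4
  | .hNext _ _ _ _ => 4
  | .hLast _ _ _ _ => 4
  | .vFirst _ _ _ _ => 4
  | .vIn _ _ _ _ _ => 4
  | .vNext _ _ _ _ => 4
  | .vLast _ _ _ _ => 4
  | .subIn _ _ _ _ _ => 2
  | .subOut _ _ _ _ _ => 2
  | .shortcut i j _ _ _ => if i = j then 2 else 3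
  | .sC _ => 0
  | .dT _ => 0
  | .tA _ _ => 0
  | .bS _ _ => 0
  | .sE _ _ => 0
  | .fT _ _ => 0
  | .bE _ _ => 0
  | .connector _ _ => W m
  | .fA _ _ => 0

theorem Edge.src_tgt_injective :
    Function.Injective fun e : I.Edge => (e.src, e.tgt) := by
  intro e e' h
  rw [Prod.mk.injEq] at h
  obtain ⟨h₁, h₂⟩ := h
  cases e <;> cases e' <;>
    first
    | (exfalso; simp only [Edge.src, reduceCtorEq] at h₁; done)
    | (exfalso; simp only [Edge.tgt, reduceCtorEq] at h₂; done)
    | (simp only [Edge.src, Edge.tgt, Vertex.a.injEq, Vertex.b.injEq, Vertex.c.injEq,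
        Vertex.d.injEq, Vertex.e.injEq, Vertex.f.injEq, Vertex.left.injEq, Vertex.right.injEq,
        Vertex.top.injEq, Vertex.bottom.injEq, Vertex.grid.injEq, Vertex.sub.injEq,
        Fin.ext_iff, Fin.val_succ, Fin.val_castSucc, Fin.val_zero, Fin.val_last] at h₁ h₂
       first
       | (exfalso; omega)
       | (simp only [Edge.blueA.injEq, Edge.blueB.injEq, Edge.blueC.injEq, Edge.blueD.injEq,
           Edge.hFirst.injEq, Edge.hIn.injEq, Edge.hNext.injEq, Edge.hLast.injEq,
           Edge.vFirst.injEq, Edge.vIn.injEq, Edge.vNext.injEq, Edge.vLast.injEq,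
           Edge.subIn.injEq, Edge.subOut.injEq, Edge.shortcut.injEq, Edge.sC.injEq,
           Edge.dT.injEq, Edge.tA.injEq, Edge.bS.injEq, Edge.sE.injEq, Edge.fT.injEq,
           Edge.bE.injEq, Edge.connector.injEq, Edge.fA.injEq, Fin.ext_iff]
          omega))

noncomputable instance : Fintype I.Edge :=
  Fintype.ofInjective _ Edge.src_tgt_injective

theorem Δ_nonneg (m : ℕ) : 0 ≤ Δ m := by unfold Δ; positivity

theorem firstBlue_nonneg (i : Fin k) (x : Fin (m + 1)) :
    0 ≤ firstBlue k m (i.val + 1) (x.val + 1) := by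
  have hi : ((i.val + 1 : ℕ) : ℝ) ≤ k := by exact_mod_cast i.isLt
  have hx : ((x.val + 1 : ℕ) : ℝ) ≤ ((m + 1 : ℕ) : ℝ) := by exact_mod_cast x.isLt
  have hn : (0 : ℝ) ≤ ((m + 1 : ℕ) : ℝ) := by positivity
  refine mul_nonneg (Δ_nonneg m) ?_
  nlinarith [mul_le_mul_of_nonneg_left hi hn]

theorem lastBlue_nonneg (i x : ℕ) : 0 ≤ lastBlue m (i + 1) (x + 1) := by
  refine mul_nonneg (Δ_nonneg m) ?_
  push_cast
  have : (0 : ℝ) ≤ (m + 1) * i := by positivity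
  nlinarith [(Nat.cast_nonneg x : (0 : ℝ) ≤ x)]

theorem Edge.weight_nonneg (e : I.Edge) : 0 ≤ e.weight := by
  cases e <;> simp only [Edge.weight] <;>
    first
    | exact firstBlue_nonneg _ _
    | exact lastBlue_nonneg _ _
    | (unfold W; positivity)
    | (split_ifs <;> norm_num)
    | norm_num

/-- The weighted digraph constructed from a Grid Tiling* instance. -/
def graph (I : GridTilingStar k m) : WeightedDigraph I.Vertex I.Edge where
  src := Edge.src
  tgt := Edge.tgt
  simple := Edge.src_tgt_injective
  weight := Edge.weight
  weight_nonneg := Edge.weight_nonneg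

/-- `α = Δ (n k + 1) + 4 (k + 1) + 4 k (n - 1)` with `n = m + 1`. -/
def α (k m : ℕ) : ℝ :=
  Δ m * (((m + 1 : ℕ) : ℝ) * k + 1) + 4 * ((k : ℝ) + 1) + 4 * (k : ℝ) * (((m + 1 : ℕ) : ℝ) - 1)

/-- `β = 2 k α + W (k - 1) - (k ^ 2 + k)`. -/
def β (k m : ℕ) : ℝ :=
  2 * (k : ℝ) * α k m + W m * ((k : ℝ) - 1) - ((k : ℝ) ^ 2 + (k : ℝ))

end GridTilingStar

/-!
The proof is a weak-duality argument: a potential on the vertices bounds the cost of every path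
from below, with a surplus for every deviation from the canonical paths.

Every path `B` from `t` to `s` uses all `k - 1` connectors (`connector_mem_B`). Call a forward path
connector-free if it avoids them. The weight of each edge is charged to the forward paths or to
`B`; only the edges `subOut`, the second halves of the subdivided edges, are charged to both.
By the potentials `potF` and `potB` a connector-free forward path costs `α` plus `Δ` for every edge
that leaves its column, and `B` costs `k * α` plus `Δ` for every edge that leaves its row plus `1`
for every orange edge. So a solution costs at least the sum of these amounts and of the connectors
paid for, minus `2` for every coloured vertex whose `subOut` is used by both directions (`cost_ge`).

If the cost is at most `β`, then, `W` being much larger than `k * α` and `Δ` much larger than all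
possible savings, every connector is paid for once, exactly `k` forward paths are connector-free,
they stay in their columns, `B` stays in one row `x i` on each level `i`, and the savings minus the
orange surcharges are at least `k ^ 2 + k` (`structure_of_cost_le`). A shared vertex of `G_{i,j}`
thus brings at most `2` if `i = j` and `1` otherwise. On level `i` each of the `k` forward paths
accounts for at most one shared vertex, and since `(x, y) ∈ S i i` forces `x = y`, at most one of
them lies in `G_{i,i}`. Hence level `i` brings at most `k + 1`, with equality only if `B` meets every
connector-free path at a coloured vertex, one of them in `G_{i,i}`. As equality must hold on every
level, the `k` paths have the columns `x 0, …, x (k - 1)`, one for each `j`, and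
`γ i j = (x i, x j)` is a solution (`hasSolution_of_card`).
-/

/-! ### Walks, cuts and potentials -/

namespace WeightedDigraph

variable {V E : Type*} {G : WeightedDigraph V E} {u v : V} {p : List E}

theorem IsWalk.src_mem (h : G.IsWalk u p v) {e : E} (he : e ∈ p) :
    G.src e ∈ u :: p.map G.tgt := by
  induction p generalizing u with
  | nil => simp at he
  | cons e₀ p ih =>
    obtain ⟨h₀, h⟩ := h
    rcases List.mem_cons.1 he with rfl | he
    · simp [h₀]
    · exact List.mem_cons_of_mem _ (ih h he)

/-- A walk that starts outside `A` and visits `A` has an edge entering `A`. -/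
theorem IsWalk.exists_entering (h : G.IsWalk u p v) (A : V → Prop) (hu : ¬ A u) {w : V}
    (hw : w ∈ u :: p.map G.tgt) (hA : A w) : ∃ e ∈ p, ¬ A (G.src e) ∧ A (G.tgt e) := by
  induction p generalizing u with
  | nil => simp_all
  | cons e p ih =>
    obtain ⟨rfl, h⟩ := h
    by_cases he : A (G.tgt e)
    · exact ⟨e, by simp, hu, he⟩
    · have hw' : w ∈ G.tgt e :: p.map G.tgt := by
        rcases List.mem_cons.1 hw with rfl | hw
        · exact absurd hA hu
        · simpa using hw
      obtain ⟨e', he', h'⟩ := ih h he hw'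
      exact ⟨e', List.mem_cons_of_mem _ he', h'⟩

theorem IsWalk.end_mem (h : G.IsWalk u p v) : v ∈ u :: p.map G.tgt := by
  induction p generalizing u with
  | nil => simpa using h.symm
  | cons e p ih => exact List.mem_cons_of_mem _ (ih h.2)

theorem IsWalk.potential_le (h : G.IsWalk u p v) (φ : V → ℝ) (c : E → ℝ)
    (hc : ∀ e ∈ p, φ (G.tgt e) - φ (G.src e) ≤ c e) : φ v - φ u ≤ (p.map c).sum := by
  induction p generalizing u with
  | nil => cases h; simp
  | cons e p ih =>
    obtain ⟨rfl, h⟩ := h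
    have h₁ := ih h fun e' he' => hc e' (List.mem_cons_of_mem _ he')
    have h₂ := hc e (by simp)
    simp only [List.map_cons, List.sum_cons]
    linarith

namespace DiPath

theorem edges_nodup (P : G.DiPath u v) : P.edges.Nodup :=
  ((List.nodup_cons.1 P.nodup).2).of_map _

/-- A path leaves each vertex at most once. -/
theorem src_injOn (P : G.DiPath u v) {e e' : E} (he : e ∈ P.edges) (he' : e' ∈ P.edges)
    (h : G.src e = G.src e') : e = e' := by
  obtain ⟨p, hp, hn⟩ := P
  simp only at he he'
  induction p generalizing u with
  | nil => simp at he
  | cons e₀ p ih =>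
    obtain ⟨rfl, hp⟩ := hp
    have hn' := List.nodup_cons.1 hn
    have key : ∀ e₁ ∈ p, G.src e₁ ≠ G.src e₀ := fun e₁ h₁ h₂ =>
      hn'.1 (h₂ ▸ by simpa using hp.src_mem h₁)
    rcases List.mem_cons.1 he with rfl | he₁ <;> rcases List.mem_cons.1 he' with rfl | he₁'
    · rfl
    · exact absurd h.symm (key _ he₁')
    · exact absurd h (key _ he₁)
    · exact ih hp (by simpa using hn'.2) he₁ he₁'

open Classical in
/-- Weak duality for shortest paths: a potential whose increase along each edge of a path is at
most the length of the edge bounds the length of the path from below. -/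
theorem potential_le (P : G.DiPath u v) (φ : V → ℝ) (c : E → ℝ)
    (hc : ∀ e ∈ P.edges, φ (G.tgt e) - φ (G.src e) ≤ c e) :
    φ v - φ u ≤ ∑ e ∈ P.edges.toFinset, c e := by
  rw [List.sum_toFinset _ P.edges_nodup]
  exact P.isWalk.potential_le φ c hc

theorem edges_injective : Function.Injective (DiPath.edges : G.DiPath u v → List E) := by
  rintro ⟨p, _, _⟩ ⟨q, _, _⟩ h
  cases h
  rfl

instance [Finite E] : Finite (G.DiPath u v) := by
  classical
  have := Fintype.ofFinite E
  exact Finite.of_injective (fun P : G.DiPath u v => (⟨P.edges, P.edges_nodup⟩ :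
    {l : List E // l.Nodup})) fun P Q h => edges_injective (congrArg Subtype.val h)

end DiPath

instance [Finite E] {k₁ k₂ : ℕ} : Finite (G.Solution u v k₁ k₂) :=
  Finite.of_injective (fun X : G.Solution u v k₁ k₂ => (X.F, X.B)) fun X Y h => by
    cases X; cases Y; simpa using h

/-- There are finitely many solutions, so the optimum, if finite, is attained. -/
theorem exists_cost_le_of_opt_le [Fintype E] {k₁ k₂ : ℕ} {b : ℝ}
    (h : G.opt u v k₁ k₂ ≤ (b : EReal)) : ∃ X : G.Solution u v k₁ k₂, X.cost ≤ b := by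
  rcases isEmpty_or_nonempty (G.Solution u v k₁ k₂) with h₀ | h₀
  · rw [opt, iInf_of_empty, top_le_iff] at h
    exact absurd h (EReal.coe_ne_top b)
  · obtain ⟨X, hX⟩ := exists_eq_ciInf_of_finite
      (f := fun X : G.Solution u v k₁ k₂ => ((X.cost : ℝ) : EReal))
    refine ⟨X, EReal.coe_le_coe_iff.1 ?_⟩
    rw [hX]
    exact h

end WeightedDigraph

namespace GridTilingStar

variable {k m : ℕ} {I : GridTilingStar k m}

/-! ### Lower bounds for single paths -/

/-- The weight of an edge as far as it is charged to the forward paths: that of the blue edges at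
`c_j` and `d_j` and of the edges of the subdivided columns. -/
def Edge.weightF : I.Edge → ℝ
  | .blueC j y => firstBlue k m (j.val + 1) (y.val + 1)
  | .blueD j y => lastBlue m (j.val + 1) (y.val + 1)
  | .vFirst _ _ _ _ => 4
  | .vIn _ _ _ _ _ => 4
  | .vNext _ _ _ _ => 4
  | .vLast _ _ _ _ => 4
  | .subIn _ _ _ _ _ => 2
  | .subOut _ _ _ _ _ => 2
  | _ => 0

/-- The weight of an edge as far as it is charged to the backward path: that of the blue edges at
`a_i` and `b_i`, of the edges of the rows, and of the detours through subdividing vertices. The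
edges `subOut` are charged to both directions. -/
def Edge.weightB : I.Edge → ℝ
  | .blueA i x => firstBlue k m (i.val + 1) (x.val + 1)
  | .blueB i x => lastBlue m (i.val + 1) (x.val + 1)
  | .hFirst _ _ _ _ => 4
  | .hIn _ _ _ _ => 4
  | .hNext _ _ _ _ => 4
  | .hLast _ _ _ _ => 4
  | .subOut _ _ _ _ _ => 2
  | .shortcut i j _ _ _ => if i = j then 2 else 3
  | _ => 0

/-- Indicator of the edges that lead from a vertex of a column to the next column, together with
the edges joining the gadgets to `left` and `right`. The vertex `sub i j x y` counts as a vertex of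
the column `y.succ`. -/
def Edge.horizontal : I.Edge → ℕ
  | .hFirst _ _ _ _ => 1
  | .hIn _ _ _ _ => 1
  | .hNext _ _ _ _ => 1
  | .hLast _ _ _ _ => 1
  | .shortcut _ _ _ _ _ => 1
  | _ => 0

/-- Indicator of the edges that lead from a vertex of a row to the next row, together with the
edges joining the gadgets to `top` and `bottom`. The vertex `sub i j x y` counts as a vertex of
the row `x.succ`. -/
def Edge.vertical : I.Edge → ℕ
  | .vFirst _ _ _ _ => 1
  | .vIn _ _ _ _ _ => 1
  | .vNext _ _ _ _ => 1
  | .vLast _ _ _ _ => 1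
  | .subIn _ _ _ _ _ => 1
  | _ => 0

/-- Indicator of the orange edges. -/
def Edge.orange : I.Edge → ℕ
  | .shortcut i j _ _ _ => if i = j then 0 else 1
  | _ => 0

/-- Potential for the forward paths: the cost of reaching a vertex along a vertical canonical
path. From the vertices `right`, `b` and `e` a path continues only through a connector or to `s`,
so their potential may be as low as `0`; the vertices `f`, `a` and `left`, which no path from `s`
reaches without a connector or `t`, get the same potential `α` as `t`. -/
def potF : I.Vertex → ℝ
  | .s | .b _ | .c _ | .e _ _ | .right _ _ => 0
  | .top j y => Δ m * ((m + 1) * k - ((m + 1) * j.val + y.val))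
  | .grid i j x y => Δ m * ((m + 1) * k - ((m + 1) * j.val + y.val)) +
      4 * (1 + ((m + 1) * i.val + x.val))
  | .sub i j x y _ => Δ m * ((m + 1) * k - ((m + 1) * j.val + y.val + 1)) +
      4 * (1 + ((m + 1) * i.val + x.val)) + 2
  | .bottom j y => Δ m * ((m + 1) * k - ((m + 1) * j.val + y.val)) + 4 * ((m + 1) * k + 1)
  | .t | .d _ | .f _ _ | .a _ | .left _ _ => α k m

/-- Potential for the backward path: the cost of reaching a vertex along the horizontal canonical
paths of the levels `k - 1`, `k - 2`, …, each level costing `α`. The vertices that are no use on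
the way to `s` get the potential of `t` if they lie below the gadgets and that of `s` if they lie
above them. -/
def potB : I.Vertex → ℝ
  | .t | .bottom _ _ | .d _ => 0
  | .s | .c _ | .top _ _ => k * α k m
  | .a i => (k - 1 - i.val) * α k m
  | .b i => (k - i.val) * α k m
  | .e i _ | .f i _ => (k - 1 - i.val) * α k m
  | .left i x => (k - 1 - i.val) * α k m + Δ m * ((m + 1) * k - ((m + 1) * i.val + x.val))
  | .grid i j x y => (k - 1 - i.val) * α k m +
      Δ m * ((m + 1) * k - ((m + 1) * i.val + x.val)) + 4 * (1 + ((m + 1) * j.val + y.val))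
  | .sub i j x y _ => (k - 1 - i.val) * α k m +
      Δ m * ((m + 1) * k - ((m + 1) * i.val + x.val + 1)) +
      4 * (1 + ((m + 1) * j.val + y.val)) + 2
  | .right i x => (k - 1 - i.val) * α k m +
      Δ m * ((m + 1) * k - ((m + 1) * i.val + x.val)) + 4 * ((m + 1) * k + 1)

theorem α_eq (k m : ℕ) :
    α k m = Δ m * ((m + 1) * k + 1) + 4 * (((m + 1 : ℝ)) * k + 1) := by
  unfold α; push_cast; ring

theorem α_ge_Δ (k m : ℕ) : Δ m ≤ α k m := by
  rw [α_eq]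
  have := Δ_nonneg m
  have : 0 ≤ Δ m * ((m + 1) * k) := by positivity
  nlinarith [(by positivity : (0 : ℝ) ≤ (m + 1) * k)]

theorem firstBlue_eq (j y : ℕ) :
    firstBlue k m (j + 1) (y + 1) = Δ m * ((m + 1) * k - ((m + 1) * j + y)) := by
  unfold firstBlue; push_cast; ring

theorem lastBlue_eq (j y : ℕ) :
    lastBlue m (j + 1) (y + 1) = Δ m * ((m + 1) * j + y + 1) := by
  unfold lastBlue; push_cast; ring

/-- Row `x` of level `i` is row number `(m + 1) * i + x < (m + 1) * k` of the whole grid. -/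
theorem index_lt (i : Fin k) (x : Fin (m + 1)) :
    (m + 1 : ℝ) * i.val + x.val + 1 ≤ (m + 1) * k := by
  have hi := i.isLt
  have hx := x.isLt
  have : (m + 1) * i.val + x.val + 1 ≤ (m + 1) * k := by nlinarith
  exact_mod_cast this

theorem Δ_mul_index_le (i : Fin k) (x : Fin (m + 1)) :
    Δ m ≤ Δ m * ((m + 1 : ℝ) * k - ((m + 1) * i.val + x.val)) := by
  have := index_lt i x
  have := Δ_nonneg m
  nlinarith

/-- The edges of a path without connectors cost at least the increase of `potF`, and leaving the
column costs at least `Δ` more. Summed over a path from `s` to `t`, the increases amount to `α`. -/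
theorem potF_le (e : I.Edge) (he : ∀ i h, e ≠ .connector i h) :
    potF e.tgt - potF e.src ≤ e.weightF - Δ m * e.horizontal := by
  have hΔ := Δ_nonneg m
  cases e
  case connector i h => exact absurd rfl (he i h)
  all_goals
    simp only [Edge.src, Edge.tgt, potF, Edge.weightF, Edge.horizontal, firstBlue_eq,
      lastBlue_eq, α_eq, Fin.val_succ, Fin.val_castSucc, Fin.val_zero, Fin.val_last,
      Nat.cast_add, Nat.cast_one, Nat.cast_zero]
  case hFirst i j h x =>
    have h₁ : (0 : ℝ) ≤ (m + 1) * j.val := by positivity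
    have h₂ := index_lt i x
    nlinarith [mul_nonneg hΔ h₁]
  case hLast i j h x =>
    have h₁ := Δ_mul_index_le j (Fin.last m)
    rw [Fin.val_last] at h₁
    have h₂ : (0 : ℝ) ≤ (m + 1) * i.val + x.val := by positivity
    linarith
  case vFirst i j h y => rw [h]; push_cast; linarith
  case vLast i j h y =>
    have : (i.val : ℝ) + 1 = k := by exact_mod_cast h
    rw [← this]
    linarith
  all_goals nlinarith

/-- Every edge costs at least the increase of `potB`; leaving the row costs at least `Δ` more, and
an orange edge `1` more. Summed over a path from `t` to `s`, the increases amount to `k * α`. -/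
theorem potB_le (e : I.Edge) :
    potB e.tgt - potB e.src ≤ e.weightB - Δ m * e.vertical - e.orange := by
  have hΔ := Δ_nonneg m
  have hα : 0 ≤ α k m := hΔ.trans (α_ge_Δ k m)
  cases e
  all_goals
    simp only [Edge.src, Edge.tgt, potB, Edge.weightB, Edge.vertical, Edge.orange, firstBlue_eq,
      lastBlue_eq, Fin.val_succ, Fin.val_castSucc, Fin.val_zero, Fin.val_last,
      Nat.cast_add, Nat.cast_one, Nat.cast_zero]
  case blueB i x => rw [α_eq]; linarith
  case hFirst i j h x => rw [h]; push_cast; linarith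
  case hLast i j h x =>
    have : (j.val : ℝ) + 1 = k := by exact_mod_cast h
    rw [← this]
    linarith
  case vFirst i j h y =>
    have := index_lt j y
    rw [h, α_eq]
    push_cast
    linarith
  case vNext i j h y =>
    have := α_ge_Δ k m
    nlinarith
  case vLast i j h y =>
    have h₁ := Δ_mul_index_le i (Fin.last m)
    rw [Fin.val_last] at h₁
    have h₂ : (i.val : ℝ) + 1 = k := by exact_mod_cast h
    have h₃ : (k - 1 - i.val : ℝ) = 0 := by linarith
    rw [h₃]
    have h₄ : (0 : ℝ) ≤ (m + 1) * j.val + y.val := by positivity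
    linarith
  case shortcut i j x y h => split_ifs <;> push_cast <;> linarith
  case tA i h =>
    have h₂ : (i.val : ℝ) + 1 = k := by exact_mod_cast h
    have h₃ : (k - 1 - i.val : ℝ) = 0 := by linarith
    rw [h₃]; linarith
  case bS i h => rw [h]; push_cast; linarith
  case fT i h =>
    have h₂ : (i.val : ℝ) + 1 ≤ k := by exact_mod_cast i.isLt
    nlinarith
  all_goals nlinarith

/-! ### The cost of a solution -/

/-- A coloured vertex `grid i j x.succ y.succ`, that is, an element `(x, y)` of some `S i j`. -/
@[ext]
structure Cell (I : GridTilingStar k m) : Type where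
  i : Fin k
  j : Fin k
  x : Fin m
  y : Fin m
  mem : (x, y) ∈ I.S i j

theorem Cell.toProd_injective :
    Function.Injective fun q : I.Cell => (q.i, q.j, q.x, q.y) := by
  intro q q' h
  simp only [Prod.mk.injEq] at h
  exact Cell.ext h.1 h.2.1 h.2.2.1 h.2.2.2

noncomputable instance : Fintype I.Cell := Fintype.ofInjective _ Cell.toProd_injective

def Cell.subOut (q : I.Cell) : I.Edge := .subOut q.i q.j q.x q.y q.mem

def Cell.shortcut (q : I.Cell) : I.Edge := .shortcut q.i q.j q.x q.y q.mem

theorem Cell.shortcut_injective : Function.Injective (Cell.shortcut : I.Cell → I.Edge) := by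
  rintro ⟨⟩ ⟨⟩ h
  simpa [Cell.shortcut] using h

theorem Cell.card_le : Fintype.card I.Cell ≤ k * (k * (m * m)) := by
  simpa using Fintype.card_le_of_injective _ (Cell.toProd_injective (I := I))

def Edge.IsConnector (e : I.Edge) : Prop := ∃ i h, e = .connector i h

section Solution

variable (X : I.graph.Solution .s .t (2 * k - 1) 1)

open Classical in
/-- The forward paths that avoid all connectors. -/
noncomputable def connectorFree : Finset (Fin (2 * k - 1)) :=
  Finset.univ.filter fun f => ∀ e ∈ (X.F f).edges, ¬ e.IsConnector

open Classical in
/-- The coloured vertices at which the backward path meets a forward path without connectors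
in such a way that both use the edge `subOut`. -/
noncomputable def shared : Finset I.Cell :=
  Finset.univ.filter fun q => q.subOut ∈ (X.B 0).edges ∧
    ∃ f ∈ connectorFree X, q.subOut ∈ (X.F f).edges

open Classical in
/-- The number of connectors that are paid for, with multiplicity. -/
noncomputable def connectorCount : ℕ :=
  ∑ e ∈ Finset.univ.filter Edge.IsConnector, X.mult e

open Classical in
/-- The number of horizontal edges of the connector-free forward paths, with multiplicity. -/
noncomputable def horizontalCount : ℕ :=
  ∑ f ∈ connectorFree X, ∑ e ∈ (X.F f).edges.toFinset, e.horizontal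

open Classical in
/-- The number of vertical edges of the backward path. -/
noncomputable def verticalCount : ℕ := ∑ e ∈ (X.B 0).edges.toFinset, e.vertical

open Classical in
/-- The number of orange edges of the backward path. -/
noncomputable def orangeCount : ℕ := ∑ e ∈ (X.B 0).edges.toFinset, e.orange

variable {X}

theorem mem_shared {q : I.Cell} : q ∈ shared X ↔ q.subOut ∈ (X.B 0).edges ∧
    ∃ f ∈ connectorFree X, q.subOut ∈ (X.F f).edges := by
  simp [shared]

open Classical in
theorem card_filter_mem_F_le_mult (s : Finset (Fin (2 * k - 1))) (e : I.Edge) :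
    (s.filter fun f => e ∈ (X.F f).edges).card ≤ X.mult e :=
  (Finset.card_le_card (Finset.filter_subset_filter _ (Finset.subset_univ s))).trans
    (le_max_left _ _)

open Classical in
theorem one_le_mult_of_mem_B {e : I.Edge} (he : e ∈ (X.B 0).edges) : 1 ≤ X.mult e := by
  refine le_trans ?_ (le_max_right _ _)
  exact Finset.card_pos.2 ⟨0, by simpa using he⟩

open Classical in
/-- Charging the weight of an edge to the forward paths and to the backward path counts only the
edges `subOut` twice, and those only at the shared coloured vertices. -/
theorem weight_mul_mult_ge (e : I.Edge) :
    ((e.weightF * ((connectorFree X).filter fun f => e ∈ (X.F f).edges).card +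
      (if e ∈ (X.B 0).edges then e.weightB else 0)) +
      (if e.IsConnector then W m * X.mult e else 0)) -
      (if e ∈ (shared X).image Cell.subOut then 2 else 0) ≤ e.weight * X.mult e := by
  have hF := card_filter_mem_F_le_mult (X := X) (connectorFree X) e
  set c := ((connectorFree X).filter fun f => e ∈ (X.F f).edges).card with hc
  have hF' : (c : ℝ) ≤ X.mult e := by exact_mod_cast hF
  have hB : (if e ∈ (X.B 0).edges then e.weightB else 0) ≤ e.weightB * X.mult e := by
    have hw : 0 ≤ e.weightB := by
      have := e.weight_nonneg
      cases e <;> simp only [Edge.weightB, le_refl] <;> exact this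
    split_ifs with h
    · have : (1 : ℝ) ≤ X.mult e := by exact_mod_cast one_le_mult_of_mem_B h
      exact le_mul_of_one_le_right hw this
    · positivity
  have hS : (0 : ℝ) ≤ if e ∈ (shared X).image Cell.subOut then 2 else 0 := by
    split_ifs <;> norm_num
  have hw := e.weight_nonneg
  by_cases hcon : e.IsConnector
  -- A connector is charged to neither direction; of the other edges of positive weight only
  -- `subOut` is charged to both.
  · obtain ⟨i, h, rfl⟩ := hcon
    have : (Edge.connector i h : I.Edge).IsConnector := ⟨i, h, rfl⟩
    rw [if_pos this]
    simp only [Edge.weightF, Edge.weightB, Edge.weight] at hB ⊢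
    linarith
  rw [if_neg hcon]
  cases e
  case connector i h => exact absurd ⟨i, h, rfl⟩ hcon
  case subOut i j x y h =>
    simp only [Edge.weightF, Edge.weightB, Edge.weight] at hB ⊢
    rcases Nat.eq_zero_or_pos c with h₀ | h₀
    · rw [h₀]; push_cast; linarith
    · by_cases hb : (Edge.subOut i j x y h : I.Edge) ∈ (X.B 0).edges
      · obtain ⟨f, hf⟩ := Finset.card_pos.1 (hc ▸ h₀)
        rw [Finset.mem_filter] at hf
        rw [if_pos hb, if_pos]
        · linarith
        · exact Finset.mem_image.2 ⟨⟨i, j, x, y, h⟩, mem_shared.2 ⟨hb, f, hf⟩, rfl⟩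
      · rw [if_neg hb]; linarith
  all_goals
    simp only [Edge.weightF, Edge.weightB, Edge.weight] at hB hw ⊢
    first
    | linarith
    | nlinarith [mul_le_mul_of_nonneg_left hF' hw]

open Classical in
theorem cost_ge_sum_edges :
    (∑ f ∈ connectorFree X, ∑ e ∈ (X.F f).edges.toFinset, e.weightF) +
      ∑ e ∈ (X.B 0).edges.toFinset, e.weightB + W m * connectorCount X - 2 * (shared X).card ≤
      X.cost := by
  have h := Finset.sum_le_sum fun e (_ : e ∈ Finset.univ) => weight_mul_mult_ge (X := X) e
  rw [Finset.sum_sub_distrib, Finset.sum_add_distrib, Finset.sum_add_distrib] at h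
  have h₁ : ∑ e : I.Edge,
      e.weightF * ((connectorFree X).filter fun f => e ∈ (X.F f).edges).card =
      ∑ f ∈ connectorFree X, ∑ e ∈ (X.F f).edges.toFinset, e.weightF := by
    simp only [Finset.card_filter, Nat.cast_sum, Finset.mul_sum]
    rw [Finset.sum_comm]
    refine Finset.sum_congr rfl fun f _ => ?_
    rw [← Finset.sum_filter_add_sum_filter_not Finset.univ (· ∈ (X.F f).edges),
      Finset.sum_eq_zero (s := Finset.univ.filter (· ∉ (X.F f).edges)), add_zero]
    · refine Finset.sum_congr (by ext; simp) fun e he => ?_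
      simp [List.mem_toFinset.1 he]
    · intro e he
      simp [(Finset.mem_filter.1 he).2]
  have h₂ : ∑ e : I.Edge, (if e ∈ (X.B 0).edges then e.weightB else 0) =
      ∑ e ∈ (X.B 0).edges.toFinset, e.weightB := by
    rw [← Finset.sum_filter]
    exact Finset.sum_congr (by ext; simp) fun _ _ => rfl
  have h₃ : ∑ e : I.Edge, (if e.IsConnector then W m * X.mult e else 0) =
      W m * connectorCount X := by
    rw [← Finset.sum_filter, connectorCount, Nat.cast_sum, Finset.mul_sum]
  have h₄ : ∑ e : I.Edge, (if e ∈ (shared X).image Cell.subOut then (2 : ℝ) else 0) ≤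
      2 * (shared X).card := by
    rw [← Finset.sum_filter, Finset.sum_const, nsmul_eq_mul, mul_comm, Finset.filter_mem_eq_inter,
      Finset.univ_inter]
    have : (((shared X).image Cell.subOut).card : ℝ) ≤ (shared X).card := by
      exact_mod_cast Finset.card_image_le
    linarith
  rw [h₁, h₂, h₃] at h
  have h₅ : X.cost = ∑ e : I.Edge, e.weight * X.mult e := rfl
  linarith

/-- The lower bound for the cost: every connector-free forward path pays `α`, the backward path
pays `α` on each of the `k` levels, and only sharing a `subOut` saves anything. -/
theorem cost_ge :
    ((connectorFree X).card + k) * α k m + Δ m * (horizontalCount X + verticalCount X) +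
      orangeCount X + W m * connectorCount X - 2 * (shared X).card ≤ X.cost := by
  classical
  have hF : ∀ f ∈ connectorFree X, α k m + Δ m * ∑ e ∈ (X.F f).edges.toFinset, e.horizontal ≤
      ∑ e ∈ (X.F f).edges.toFinset, e.weightF := by
    intro f hf
    have := (X.F f).potential_le potF (fun e => e.weightF - Δ m * e.horizontal) fun e he =>
      potF_le e fun i h h' => (Finset.mem_filter.1 hf).2 e he ⟨i, h, h'⟩
    rw [Finset.sum_sub_distrib, ← Finset.mul_sum] at this
    simp only [potF] at this
    push_cast
    linarith
  have hF' := Finset.sum_le_sum hF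
  rw [Finset.sum_add_distrib, Finset.sum_const, nsmul_eq_mul, ← Finset.mul_sum] at hF'
  have hB := (X.B 0).potential_le potB
    (fun e => e.weightB - Δ m * e.vertical - e.orange) fun e _ => potB_le e
  rw [Finset.sum_sub_distrib, Finset.sum_sub_distrib, ← Finset.mul_sum] at hB
  simp only [potB] at hB
  have := cost_ge_sum_edges (X := X)
  unfold horizontalCount verticalCount orangeCount
  push_cast at hF' hB ⊢
  linarith

/-! ### Connectors -/

/-- The vertices that the backward path can reach only after the connector `connector i _`. -/
def AfterConnector (i : ℕ) : I.Vertex → Prop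
  | .s | .c _ | .top _ _ => True
  | .t | .d _ | .bottom _ _ => False
  | .a j | .b j | .left j _ | .right j _ | .grid j _ _ _ | .sub j _ _ _ _ | .f j _ => j.val ≤ i
  | .e j _ => j.val < i

theorem connector_mem_B (i : Fin k) (h : i.val + 1 < k) :
    (Edge.connector i h : I.Edge) ∈ (X.B 0).edges := by
  obtain ⟨e, he, h₁, h₂⟩ := (X.B 0).isWalk.exists_entering (AfterConnector i.val) (by
    simp [AfterConnector]) (X.B 0).isWalk.end_mem (by simp [AfterConnector])
  change ¬ AfterConnector i.val e.src at h₁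
  change AfterConnector i.val e.tgt at h₂
  cases e
  case connector j hj =>
    simp only [Edge.src, Edge.tgt, AfterConnector] at h₁ h₂
    obtain rfl : i = j := Fin.ext (by omega)
    exact he
  all_goals
    simp only [Edge.src, Edge.tgt, AfterConnector, not_true_eq_false, not_false_eq_true]
      at h₁ h₂ <;> omega

/-- The backward path pays for every connector. -/
theorem le_connectorCount : k - 1 ≤ connectorCount X := by
  classical
  have h₁ : (Finset.univ : Finset (Fin (k - 1))).card ≤
      (Finset.univ.filter (Edge.IsConnector (I := I))).card := by
    refine Finset.card_le_card_of_injOn (fun i => Edge.connector ⟨i.val, by omega⟩ (by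
      simp only; omega)) (fun i _ => ?_) fun i _ j _ hij => ?_
    · simp only [Finset.coe_filter, Finset.mem_univ, true_and, Set.mem_ofPred_eq]
      exact ⟨_, _, rfl⟩
    · simpa [Fin.ext_iff] using hij
  have h₂ := Finset.card_nsmul_le_sum (Finset.univ.filter (Edge.IsConnector (I := I))) X.mult 1
    fun e he => by
      obtain ⟨i, h, rfl⟩ := (Finset.mem_filter.1 he).2
      exact one_le_mult_of_mem_B (connector_mem_B i h)
  simp only [Finset.card_univ, Fintype.card_fin, smul_eq_mul, mul_one] at h₁ h₂
  exact h₁.trans h₂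

/-- Each forward path that is not connector-free pays for some connector. -/
theorem card_connectorFree_add_connectorCount_ge :
    2 * k - 1 ≤ (connectorFree X).card + connectorCount X := by
  classical
  have h₁ : (Finset.univ.filter fun f => ¬ ∀ e ∈ (X.F f).edges, ¬ e.IsConnector).card ≤
      connectorCount X := by
    calc _ ≤ ∑ f : Fin (2 * k - 1), ((Finset.univ.filter (Edge.IsConnector (I := I))).filter
          fun e => e ∈ (X.F f).edges).card := by
          rw [Finset.card_filter]
          refine Finset.sum_le_sum fun f _ => ?_
          split_ifs with h
          · exact Nat.zero_le _
          · push Not at h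
            obtain ⟨e, he, he'⟩ := h
            exact Finset.card_pos.2 ⟨e, by simp [he, he']⟩
      _ = ∑ e ∈ Finset.univ.filter (Edge.IsConnector (I := I)),
          (Finset.univ.filter fun f => e ∈ (X.F f).edges).card := by
          simp only [Finset.card_filter]
          exact Finset.sum_comm
      _ ≤ _ := Finset.sum_le_sum fun e _ => card_filter_mem_F_le_mult _ e
  have h₂ := Finset.card_filter_add_card_filter_not (s := Finset.univ)
    fun f => ∀ e ∈ (X.F f).edges, ¬ e.IsConnector
  rw [Finset.card_univ, Fintype.card_fin] at h₂
  have h₃ : (connectorFree X).card =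
    (Finset.univ.filter fun f => ∀ e ∈ (X.F f).edges, ¬ e.IsConnector).card := rfl
  omega

/-! ### Solutions within the budget -/

/-- The magnitudes of `W`, `Δ` and the black weights separate: a solution of cost at most `β` uses
each connector once, has exactly `k` forward paths without connectors, none of which leaves its
column, and its backward path never leaves a row. -/
theorem structure_of_cost_le (hk : 1 ≤ k) (hkn : k ≤ m + 1) (hm : 1 ≤ m)
    (hX : X.cost ≤ β k m) :
    (connectorFree X).card = k ∧ horizontalCount X = 0 ∧ verticalCount X = 0 ∧
      orangeCount X + (k ^ 2 + k) ≤ 2 * (shared X).card := by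
  have hcost := cost_ge.trans hX
  have hN := le_connectorCount (X := X)
  have hP := card_connectorFree_add_connectorCount_ge (X := X)
  have hΔ := Δ_nonneg m
  have hΔα := α_ge_Δ k m
  have hS : (shared X).card ≤ k * (k * (m * m)) :=
    (Finset.card_le_univ _).trans Cell.card_le
  generalize connectorCount X = N at *
  generalize (connectorFree X).card = P at *
  generalize horizontalCount X = H at *
  generalize verticalCount X = V at *
  generalize orangeCount X = O at *
  generalize (shared X).card = S at *
  have hn : (2 : ℝ) ≤ (m : ℝ) + 1 := by
    have : (1 : ℝ) ≤ m := by exact_mod_cast hm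
    linarith
  have hkn' : (k : ℝ) ≤ (m : ℝ) + 1 := by exact_mod_cast hkn
  have hk' : (1 : ℝ) ≤ k := by exact_mod_cast hk
  have hS' : (S : ℝ) ≤ ((m : ℝ) + 1) ^ 4 := by
    have h₁ : S ≤ (m + 1) ^ 4 := hS.trans <| by
      calc k * (k * (m * m)) ≤ (m + 1) * ((m + 1) * ((m + 1) * (m + 1))) := by gcongr <;> omega
        _ = _ := by ring
    exact_mod_cast h₁
  have hα : α k m ≤ 7 * ((m : ℝ) + 1) ^ 6 * (((m : ℝ) + 1) * (m + 1) + 1) +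
      4 * (((m : ℝ) + 1) * (m + 1) + 1) := by
    rw [α_eq, Δ]; push_cast; gcongr
  have hΔ' : Δ m = 7 * ((m : ℝ) + 1) ^ 6 := by unfold Δ; push_cast; rfl
  have hW : W m = 53 * ((m : ℝ) + 1) ^ 9 := by unfold W; push_cast; rfl
  unfold β at hcost
  set n : ℝ := (m : ℝ) + 1
  have hn₀ : 0 < n := by linarith
  have hα₀ : 0 ≤ α k m := hΔ.trans hΔα
  -- A further connector would cost `W`, more than the rest of the budget.
  have hN' : N = k - 1 := by
    by_contra hne
    have h₁ : (k : ℝ) ≤ N := by exact_mod_cast (by omega : k ≤ N)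
    have h₂ : 0 ≤ W m := by rw [hW]; positivity
    have h₃ : W m ≤ k * α k m + 2 * S := by
      have : 0 ≤ (P : ℝ) * α k m := by positivity
      have : 0 ≤ Δ m * (H + V) := by positivity
      nlinarith
    have h₄ : k * α k m ≤ n * (7 * n ^ 6 * (n * n + 1) + 4 * (n * n + 1)) := by gcongr
    have p4 : n ^ 4 ≤ n ^ 9 := pow_le_pow_right₀ (by linarith) (by norm_num)
    have p7 : n ^ 7 ≤ n ^ 9 := pow_le_pow_right₀ (by linarith) (by norm_num)
    have p3 : n ^ 3 ≤ n ^ 9 := pow_le_pow_right₀ (by linarith) (by norm_num)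
    have p1 : n ^ 1 ≤ n ^ 9 := pow_le_pow_right₀ (by linarith) (by norm_num)
    have p9 : 0 < n ^ 9 := by positivity
    nlinarith
  subst hN'
  have hP' : k ≤ P := by omega
  rw [Nat.cast_sub hk, Nat.cast_one] at hcost
  have hcost' : ((P : ℝ) - k) * α k m + Δ m * (H + V) + O + (k ^ 2 + k) ≤ 2 * S := by linarith
  -- A further path or a change of row or column would cost `Δ`, more than can be saved by sharing.
  have hlt : 2 * (S : ℝ) < Δ m := by
    rw [hΔ']
    have p4 : n ^ 4 ≤ n ^ 6 := pow_le_pow_right₀ (by linarith) (by norm_num)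
    have : 0 < n ^ 4 := by positivity
    linarith
  have hHV : 0 ≤ Δ m * (H + V) := by positivity
  have hO : (0 : ℝ) ≤ O + (k ^ 2 + k) := by positivity
  have hP₀ : (0 : ℝ) ≤ (P : ℝ) - k := by
    have : (k : ℝ) ≤ P := by exact_mod_cast hP'
    linarith
  have hPk : P = k := by
    by_contra hne
    have : (1 : ℝ) ≤ (P : ℝ) - k := by
      have : (k : ℝ) + 1 ≤ P := by exact_mod_cast (by omega : k + 1 ≤ P)
      linarith
    nlinarith
  have hHV₀ : H + V = 0 := by
    by_contra hne
    have : (1 : ℝ) ≤ (H : ℝ) + V := by exact_mod_cast (by omega : 1 ≤ H + V)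
    nlinarith [mul_nonneg hP₀ hα₀]
  refine ⟨hPk, by omega, by omega, ?_⟩
  have : (O : ℝ) + (k ^ 2 + k) ≤ 2 * S := by nlinarith [mul_nonneg hP₀ hα₀]
  exact_mod_cast this

/-! ### The rows and columns of the paths -/

theorem horizontal_eq_zero (h : horizontalCount X = 0) {f : Fin (2 * k - 1)}
    (hf : f ∈ connectorFree X) {e : I.Edge} (he : e ∈ (X.F f).edges) : e.horizontal = 0 := by
  classical
  simp only [horizontalCount, Finset.sum_eq_zero_iff] at h
  exact h f hf e (List.mem_toFinset.2 he)

theorem vertical_eq_zero (h : verticalCount X = 0) {e : I.Edge} (he : e ∈ (X.B 0).edges) :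
    e.vertical = 0 := by
  classical
  simp only [verticalCount, Finset.sum_eq_zero_iff] at h
  exact h e (List.mem_toFinset.2 he)

/-- A backward path without vertical edges enters the subdividing vertices by shortcuts. -/
theorem shortcut_mem_B (h : verticalCount X = 0) {q : I.Cell}
    (hq : q.subOut ∈ (X.B 0).edges) : q.shortcut ∈ (X.B 0).edges := by
  obtain ⟨e, he, -, h₂⟩ := (X.B 0).isWalk.exists_entering
    (fun v => v = .sub q.i q.j q.x q.y q.mem) (by simp) ((X.B 0).isWalk.src_mem hq) rfl
  change e.tgt = _ at h₂
  have hv := vertical_eq_zero h he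
  cases e <;> simp only [Edge.tgt, Edge.vertical, reduceCtorEq, one_ne_zero] at h₂ hv
  simp only [Vertex.sub.injEq] at h₂
  obtain ⟨h₁, h₂, h₃, h₄⟩ := h₂
  subst h₁ h₂ h₃ h₄
  exact he

theorem card_offDiag_shared_le (h : verticalCount X = 0) :
    ((shared X).filter fun q => q.i ≠ q.j).card ≤ orangeCount X := by
  classical
  rw [← Finset.card_image_of_injective _ Cell.shortcut_injective, Finset.card_eq_sum_ones]
  refine (Finset.sum_le_sum (g := Edge.orange) fun e he => ?_).trans
    (Finset.sum_le_sum_of_subset fun e he => ?_)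
  all_goals
    obtain ⟨q, hq, rfl⟩ := Finset.mem_image.1 he
    rw [Finset.mem_filter] at hq
  · simp [Cell.shortcut, Edge.orange, hq.2]
  · exact List.mem_toFinset.2 (shortcut_mem_B h (mem_shared.1 hq.1).1)

/-- The vertices of row `x` of level `i`. -/
def InRow (i : Fin k) (x : Fin (m + 1)) : I.Vertex → Prop
  | .left i' x' => i' = i ∧ x' = x
  | .grid i' _ x' _ => i' = i ∧ x' = x
  | .sub i' _ x' _ _ => i' = i ∧ x'.succ = x
  | _ => False

/-- The vertices of column `y` of the gadgets `G_{·,j}`. -/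
def InColumn (j : Fin k) (y : Fin (m + 1)) : I.Vertex → Prop
  | .top j' y' => j' = j ∧ y' = y
  | .grid _ j' _ y' => j' = j ∧ y' = y
  | .sub _ j' _ y' _ => j' = j ∧ y'.succ = y
  | _ => False

/-- Without vertical edges a row can be entered only by its first blue edge. -/
theorem blueA_mem_B (h : verticalCount X = 0) {q : I.Cell}
    (hq : q.subOut ∈ (X.B 0).edges) : Edge.blueA q.i q.x.succ ∈ (X.B 0).edges := by
  obtain ⟨e, he, h₁, h₂⟩ := (X.B 0).isWalk.exists_entering (InRow q.i q.x.succ)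
    (by simp [InRow]) ((X.B 0).isWalk.src_mem hq) ⟨rfl, rfl⟩
  change ¬ InRow q.i q.x.succ e.src at h₁
  change InRow q.i q.x.succ e.tgt at h₂
  have hv := vertical_eq_zero h he
  cases e <;> simp only [Edge.src, Edge.tgt, Edge.vertical, InRow, one_ne_zero] at h₁ h₂ hv
  case blueA i x => obtain ⟨rfl, rfl⟩ := h₂; exact he
  all_goals exact absurd h₂ h₁

/-- Without horizontal edges a column can be entered only by its first blue edge. -/
theorem blueC_mem_F (h : horizontalCount X = 0) {f : Fin (2 * k - 1)}
    (hf : f ∈ connectorFree X) {q : I.Cell} (hq : q.subOut ∈ (X.F f).edges) :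
    Edge.blueC q.j q.y.succ ∈ (X.F f).edges := by
  obtain ⟨e, he, h₁, h₂⟩ := (X.F f).isWalk.exists_entering (InColumn q.j q.y.succ)
    (by simp [InColumn]) ((X.F f).isWalk.src_mem hq) ⟨rfl, rfl⟩
  change ¬ InColumn q.j q.y.succ e.src at h₁
  change InColumn q.j q.y.succ e.tgt at h₂
  have hv := horizontal_eq_zero h hf he
  cases e <;> simp only [Edge.src, Edge.tgt, Edge.horizontal, InColumn, one_ne_zero] at h₁ h₂ hv
  case blueC i x => obtain ⟨rfl, rfl⟩ := h₂; exact he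
  all_goals exact absurd h₂ h₁

theorem sC_mem_of_blueC_mem {j : Fin k} {y : Fin (m + 1)}
    (P : I.graph.DiPath .s .t) (h : Edge.blueC j y ∈ P.edges) : Edge.sC j ∈ P.edges := by
  obtain ⟨e, he, -, h₂⟩ := P.isWalk.exists_entering (fun v => v = .c j) (by simp)
    (P.isWalk.src_mem h) rfl
  change e.tgt = _ at h₂
  cases e <;> simp only [Edge.tgt, reduceCtorEq, Vertex.c.injEq] at h₂
  exact h₂ ▸ he

/-- A path from `s` to `t` leaves `s` once, and so starts at most one column. -/
theorem blueC_mem_unique {j j' : Fin k} {y y' : Fin (m + 1)} (P : I.graph.DiPath .s .t)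
    (h : Edge.blueC j y ∈ P.edges) (h' : Edge.blueC j' y' ∈ P.edges) : j = j' ∧ y = y' := by
  have h₁ := P.src_injOn (sC_mem_of_blueC_mem P h) (sC_mem_of_blueC_mem P h') rfl
  rw [Edge.sC.injEq] at h₁
  subst h₁
  exact ⟨rfl, by simpa using P.src_injOn h h' rfl⟩

theorem shared_x_eq (hV : verticalCount X = 0) {q q' : I.Cell} (hq : q ∈ shared X)
    (hq' : q' ∈ shared X) (h : q.i = q'.i) : q.x = q'.x := by
  have h₁ := blueA_mem_B hV (mem_shared.1 hq).1
  have h₂ := blueA_mem_B hV (mem_shared.1 hq').1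
  rw [h] at h₁
  simpa using (X.B 0).src_injOn h₁ h₂ rfl

end Solution

/-! ### Counting shared coloured vertices -/

open Classical in
/-- If each level meets the `k` paths in one row, and each path has one column, then there are at
most `k` shared coloured vertices on each level, at most one of them on the diagonal. So if the
shared coloured vertices, the diagonal ones counted twice, number `k ^ 2 + k`, then each level has
a diagonal one, and every path, having the column of one of these, meets each level. -/
theorem hasSolution_of_card {ι : Type*} {P : Finset ι} (hP : P.card = k) (S : Finset I.Cell)
    (hx : ∀ q ∈ S, ∀ q' ∈ S, q.i = q'.i → q.x = q'.x)
    (path : I.Cell → ι) (hpath : ∀ q ∈ S, path q ∈ P)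
    (hcol : ∀ q ∈ S, ∀ q' ∈ S, path q = path q' → q.j = q'.j ∧ q.y = q'.y)
    (hcard : k ^ 2 + k ≤ S.card + (S.filter fun q => q.i = q.j).card) : I.HasSolution := by
  set A : Fin k → Finset I.Cell := fun i => S.filter fun q => q.i = i with hA
  set D : Fin k → Finset I.Cell := fun i => (S.filter fun q => q.i = q.j).filter fun q => q.i = i
    with hD
  have memA : ∀ {i q}, q ∈ A i ↔ q ∈ S ∧ q.i = i := by simp [hA]
  have memD : ∀ {i q}, q ∈ D i ↔ (q ∈ S ∧ q.i = q.j) ∧ q.i = i := by simp [hD]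
  have hinj : ∀ i, Set.InjOn path (A i) := by
    intro i q hq q' hq' h
    rw [Finset.mem_coe, memA] at hq hq'
    obtain ⟨h₁, h₂⟩ := hcol q hq.1 q' hq'.1 h
    have h₃ := hq.2.trans hq'.2.symm
    exact Cell.ext h₃ h₁ (hx q hq.1 q' hq'.1 h₃) h₂
  have hmaps : ∀ i, Set.MapsTo path (A i) P := fun i q hq =>
    hpath q (memA.1 hq).1
  have hAk : ∀ i, (A i).card ≤ k := fun i =>
    hP ▸ Finset.card_le_card_of_injOn path (hmaps i) (hinj i)
  have hD1 : ∀ i, (D i).card ≤ 1 := by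
    intro i
    refine Finset.card_le_one.2 fun q hq q' hq' => ?_
    rw [memD] at hq hq'
    have diag : ∀ q : I.Cell, q.i = q.j → q.x = q.y := fun q h =>
      (I.diag q.i q.x q.y).1 (by simpa [← h] using q.mem)
    have h₃ := hq.2.trans hq'.2.symm
    have h₄ := hx q hq.1.1 q' hq'.1.1 h₃
    exact Cell.ext h₃ (hq.1.2.symm.trans (h₃.trans hq'.1.2)) h₄
      ((diag q hq.1.2).symm.trans (h₄.trans (diag q' hq'.1.2)))
  have hsum : ∑ i : Fin k, ((A i).card + (D i).card) =
      S.card + (S.filter fun q => q.i = q.j).card := by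
    rw [Finset.sum_add_distrib, ← Finset.card_eq_sum_card_fiberwise fun q _ => Finset.mem_univ _,
      ← Finset.card_eq_sum_card_fiberwise fun q _ => Finset.mem_univ _]
  have hle : ∀ i ∈ Finset.univ, (A i).card + (D i).card ≤ k + 1 := fun i _ =>
    Nat.add_le_add (hAk i) (hD1 i)
  have heq : ∀ i, (A i).card + (D i).card = k + 1 := by
    have h₁ : ∑ i : Fin k, ((A i).card + (D i).card) = ∑ _i : Fin k, (k + 1) := by
      refine le_antisymm (Finset.sum_le_sum hle) ?_
      rw [hsum, Finset.sum_const, Finset.card_univ, Fintype.card_fin, smul_eq_mul]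
      linarith
    exact fun i => (Finset.sum_eq_sum_iff_of_le hle).1 h₁ i (Finset.mem_univ i)
  have hdiag : ∀ i, ∃ q ∈ S, q.i = i ∧ q.j = i := by
    intro i
    obtain ⟨q, hq⟩ := Finset.card_pos.1 (by have := heq i; have := hAk i; omega : 0 < (D i).card)
    rw [memD] at hq
    exact ⟨q, hq.1.1, hq.2, hq.1.2 ▸ hq.2⟩
  choose g hgS hgi hgj using hdiag
  have hcell : ∀ i j, ∃ q ∈ S, q.i = i ∧ q.j = j ∧ q.y = (g j).y := by
    intro i j
    have hsurj : Set.SurjOn path (A i) P :=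
      Finset.surjOn_of_injOn_of_card_le path (hmaps i) (hinj i) (by
        have := heq i; have := hD1 i; omega)
    obtain ⟨q, hq, hqj⟩ := hsurj (hpath _ (hgS j))
    rw [Finset.mem_coe, memA] at hq
    obtain ⟨h₁, h₂⟩ := hcol q hq.1 _ (hgS j) hqj
    exact ⟨q, hq.1, hq.2, h₁.trans (hgj j), h₂⟩
  refine ⟨fun i j => ((g i).x, (g j).y), fun i j => ?_, fun _ _ _ => rfl, fun _ _ _ => rfl⟩
  obtain ⟨q, hq, rfl, rfl, hy⟩ := hcell i j
  change ((g q.i).x, (g q.j).y) ∈ _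
  rw [hx _ (hgS q.i) q hq (hgi _), ← hy]
  exact q.mem

end GridTilingStar

theorem mainTheorem4 (k m : ℕ) (hk : 1 ≤ k) (hkn : k ≤ m + 1) (I : GridTilingStar k m)
    (hopt : I.graph.opt .s .t (2 * k - 1) 1 ≤ ((GridTilingStar.β k m : ℝ) : EReal)) :
    I.HasSolution := by
  classical
  obtain ⟨X, hX⟩ := WeightedDigraph.exists_cost_le_of_opt_le hopt
  have hm : 1 ≤ m := by
    obtain ⟨p, -⟩ := I.nonempty ⟨0, hk⟩ ⟨0, hk⟩
    exact (Nat.zero_le _).trans_lt p.1.isLt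
  obtain ⟨hP, hH, hV, hS⟩ := GridTilingStar.structure_of_cost_le hk hkn hm hX
  have hmeet : ∀ q : I.Cell, ∃ f, q ∈ GridTilingStar.shared X →
      f ∈ GridTilingStar.connectorFree X ∧ q.subOut ∈ (X.F f).edges := by
    intro q
    by_cases hq : q ∈ GridTilingStar.shared X
    · obtain ⟨f, hf⟩ := (GridTilingStar.mem_shared.1 hq).2
      exact ⟨f, fun _ => hf⟩
    · exact ⟨⟨0, by omega⟩, fun h => absurd h hq⟩
  choose path hpath using hmeet
  refine GridTilingStar.hasSolution_of_card hP (GridTilingStar.shared X)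
    (fun q hq q' hq' => GridTilingStar.shared_x_eq hV hq hq') path (fun q hq => (hpath q hq).1)
    (fun q hq q' hq' h => ?_) ?_
  · have h₁ := GridTilingStar.blueC_mem_F hH (hpath q hq).1 (hpath q hq).2
    have h₂ := GridTilingStar.blueC_mem_F hH (hpath q' hq').1 (hpath q' hq').2
    rw [← h] at h₂
    simpa using GridTilingStar.blueC_mem_unique _ h₁ h₂
  · have h₁ := GridTilingStar.card_offDiag_shared_le hV
    have h₂ := Finset.card_filter_add_card_filter_not (s := GridTilingStar.shared X)
      fun q => q.i = q.j
    simp only [ne_eq] at h₁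
    omega
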